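/- \textbf{Model.} An agent walks along an infinite line, one step at a time, away from a sink at location $0$ and places relays. Fix integers $A\ge 0$, $B\ge 1$, a finite nonempty set $\mathcal S\subset\mathbb R$ of transmit power levels, real multipliers $\xi_{out},\xi_{relay}\ge 0$, a measurable space $\mathcal W$ with a probability measure $p_W$ (the law of the shadowing of a link), and outage probabilities $Q_{out}(r,\gamma,w)\in[0,1]$ for $r\in\{1,2,\dots\}$, $\gamma\in\mathcal S$, $w\in\mathcal W$, measurable in $w$ and nondecreasing in $r$. After each placed node (the sink being the first) the agent skips $A$ locations. Then, at each distance $r\in\{A+1,\dots,A+B\}$ reached from the previous node, the agent measures the shadowing $w$ of the link to that node and either places a relay there and selects its power $\gamma\in\mathcal S$, or walks one more step; at distance $A+B$ a relay must be placed. The measured shadowings are i.i.d. with law $p_W$. Placing at state $(r,w)$ with power $\gamma$ costs $\gamma+\xi_{out}Q_{out}(r,\gamma,w)+\xi_{relay}$. A policy chooses each action measurably as a function of all observations so far, and may randomize. Let $N_x$ be the number of relays placed at locations $1,\dots,x$, let $\Gamma_i$ be the power of relay $i$, and let $Q_{out}^{(i,i-1)}$ be the outage probability of the link from relay $i$ to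 the previous node. A policy is \emph{average-cost optimal} if, among all these policies $\pi$, it minimizes $$\limsup_{x\to\infty}\frac1x\,\mathbb E_\pi\sum_{i=1}^{N_x}\bigl(\Gamma_i+\xi_{out}Q_{out}^{(i,i-1)}+\xi_{relay}\bigr).$$ \textbf{Theorem.} There are real thresholds $c_{th}(r)$, $A+1\le r\le A+B-1$, nondecreasing in $r$ and not depending on $w$, such that the following stationary deterministic policy (OptAsYouGo) is average-cost optimal. At a state $(r,w)$ with $A+1\le r\le A+B-1$, place a relay if and only if $\min_{\gamma\in\mathcal S}\bigl(\gamma+\xi_{out}Q_{out}(r,\gamma,w)\bigr)\le c_{th}(r)$; at a state $(A+B,w)$, always place a relay; whenever a relay is placed at $(r,w)$, give it a power in $\operatorname{argmin}_{\gamma\in\mathcal S}\bigl(\gamma+\xi_{out}Q_{out}(r,\gamma,w)\bigr)$. Such a measurable policy exists, and it is optimal for every measurable choice of the minimizers. -/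

import Mathlib

open MeasureTheory Filter

namespace PureAsYouGo

/-- Data and standing assumptions of impromptu relay deployment along an infinite line.
Lengths are measured in steps. The space `𝒲` of shadowing values is an arbitrary measurable
space; a finite set and a Borel subset of the positive reals are special cases. -/
structure Model (𝒲 : Type*) [MeasurableSpace 𝒲] where
  /-- number of locations skipped after each placed node -/
  A : ℕ
  /-- number of locations, after the skipped ones, at which a node may be placed -/
  B : ℕ
  B_pos : 1 ≤ B
  /-- the finite set of transmit power levels -/
  powers : Finset ℝ
  powers_nonempty : powers.Nonempty
  /-- `Qout r γ w`: outage probability of a link of length `r` with transmit power `γ` and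
  shadowing `w` -/
  Qout : ℕ → ℝ → 𝒲 → ℝ
  Qout_nonneg : ∀ r, 1 ≤ r → ∀ γ ∈ powers, ∀ w, 0 ≤ Qout r γ w
  Qout_le_one : ∀ r, 1 ≤ r → ∀ γ ∈ powers, ∀ w, Qout r γ w ≤ 1
  Qout_measurable : ∀ r, 1 ≤ r → ∀ γ ∈ powers, Measurable (Qout r γ)
  /-- the outage probability is increasing in the length of the link -/
  Qout_mono : ∀ γ ∈ powers, ∀ w, MonotoneOn (fun r => Qout r γ w) (Set.Ici 1)
  /-- cost multiplier of the outage -/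
  ξout : ℝ
  ξout_nonneg : 0 ≤ ξout
  /-- cost of a relay -/
  ξrelay : ℝ
  ξrelay_nonneg : 0 ≤ ξrelay
  /-- the law of the shadowing of a link -/
  law : Measure 𝒲
  law_prob : IsProbabilityMeasure law

variable {𝒲 : Type*} [MeasurableSpace 𝒲]

namespace Model

/-- Power plus weighted outage of a link. -/
def linkCost (m : Model 𝒲) (r : ℕ) (γ : ℝ) (w : 𝒲) : ℝ :=
  γ + m.ξout * m.Qout r γ w

/-- `min_γ (γ + ξout * Qout r γ w)`, the minimum being over the available power levels. -/
noncomputable def minLinkCost (m : Model 𝒲) (r : ℕ) (w : 𝒲) : ℝ :=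
  m.powers.inf' m.powers_nonempty (fun γ => m.linkCost r γ w)

/-- Actions: `none` means "do not place, walk one more step", `some γ` means
"place a relay here and let it transmit at power `γ`". -/
abbrev Action (m : Model 𝒲) : Type := Option {γ : ℝ // γ ∈ m.powers}

/-- What becomes available at one decision instant: the measured shadowing of the link from the
current location to the previous node, and a random seed that the policy may use to randomize. -/
abbrev Obs (𝒲 : Type*) : Type _ := 𝒲 × unitInterval

/-- Sequences of observations at the decision instants `0, 1, 2, …`. -/
abbrev Path (𝒲 : Type*) : Type _ := ℕ → Obs 𝒲

/-- Each decision instant involves a link not measured before. So the measured shadowings are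
i.i.d. with law `m.law`, whatever the policy; the seeds are uniform on `[0, 1]`, independent of
each other and of the shadowings. -/
noncomputable def pathMeasure (m : Model 𝒲) : Measure (Path 𝒲) :=
  Measure.infinitePi (fun _ : ℕ => m.law.prod (volume : Measure unitInterval))

end Model

/-- A (history dependent, possibly randomized) pure as-you-go placement policy. At the decision
instant `k`, at distance `r` from the previous node, the action may depend on everything that
has been observed so far. (Previous distances and actions are functions of these observations.)
At distance `A + B` a relay must be placed. -/
structure Policy (m : Model 𝒲) where
  act : (k : ℕ) → ℕ → (Fin (k + 1) → Model.Obs 𝒲) → m.Action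
  measurable_act : ∀ k r (a : m.Action), MeasurableSet {h | act k r h = a}
  must_place : ∀ k h, act k (m.A + m.B) h ≠ none

namespace Policy

variable {m : Model 𝒲}

/-- The action taken at instant `k` when the distance to the previous node is `r`. -/
def actAt (π : Policy m) (ω : Model.Path 𝒲) (k r : ℕ) : m.Action :=
  π.act k r (fun i => ω i)

/-- Distance between the agent and the previous node at the `k`-th decision instant. After a
placement the agent skips `A` locations, so that the next decision is made at distance `A + 1`. -/
def dist (π : Policy m) (ω : Model.Path 𝒲) : ℕ → ℕ
  | 0 => m.A + 1
  | k + 1 =>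
    match π.actAt ω k (π.dist ω k) with
    | none => π.dist ω k + 1
    | some _ => m.A + 1

/-- Distance between the agent and the sink at the `k`-th decision instant. -/
def pos (π : Policy m) (ω : Model.Path 𝒲) : ℕ → ℕ
  | 0 => m.A + 1
  | k + 1 =>
    match π.actAt ω k (π.dist ω k) with
    | none => π.pos ω k + 1
    | some _ => π.pos ω k + (m.A + 1)

/-- Cost incurred at the `k`-th decision instant: the hop cost
`γ + ξout * Qout r γ w + ξrelay` if a relay with power `γ` is placed, and zero otherwise. -/
def stageCost (π : Policy m) (ω : Model.Path 𝒲) (k : ℕ) : ℝ :=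
  match π.actAt ω k (π.dist ω k) with
  | none => 0
  | some γ => m.linkCost (π.dist ω k) γ (ω k).1 + m.ξrelay

/-- Total hop cost of the relays placed at locations up to `x` steps from the sink. Since
`pos k ≥ k + 1`, only the decision instants `k < x` can contribute. -/
def totalCost (π : Policy m) (x : ℕ) (ω : Model.Path 𝒲) : ℝ :=
  ∑ k ∈ Finset.range x, if π.pos ω k ≤ x then π.stageCost ω k else 0

/-- Long-run expected average cost per step. -/
noncomputable def avgCost (π : Policy m) : EReal :=
  limsup (fun x : ℕ => (((∫ ω, π.totalCost x ω ∂m.pathMeasure) / (x : ℝ) : ℝ) : EReal)) atTop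

/-- Optimality for the problem of minimizing the long-run average cost over all policies. -/
def IsAverageCostOptimal (π : Policy m) : Prop :=
  ∀ π' : Policy m, π.avgCost ≤ π'.avgCost

end Policy

/-- A stationary deterministic Markov policy: a measurable map from the states `(r, w)` to the
actions that places a relay at the states `(A + B, w)`. -/
structure StationaryPolicy (m : Model 𝒲) where
  act : ℕ → 𝒲 → m.Action
  measurable_act : ∀ r (a : m.Action), MeasurableSet {w | act r w = a}
  must_place : ∀ w, act (m.A + m.B) w ≠ none

namespace StationaryPolicy

variable {m : Model 𝒲}

/-- A stationary policy as a placement policy. -/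
def toPolicy (μ : StationaryPolicy m) : Policy m where
  act k r h := μ.act r (h (Fin.last k)).1
  measurable_act k r a :=
    (measurable_fst.comp (measurable_pi_apply (Fin.last k))) (μ.measurable_act r a)
  must_place k h := μ.must_place (h (Fin.last k)).1

/-- `μ` is an OptAsYouGo policy with thresholds `c`. -/
structure IsOptAsYouGo (μ : StationaryPolicy m) (c : ℕ → ℝ) : Prop where
  /-- at `(r, w)` with `A + 1 ≤ r ≤ A + B - 1`, place iff the link is at most the threshold -/
  place_iff : ∀ r, m.A + 1 ≤ r → r < m.A + m.B → ∀ w,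
    μ.act r w ≠ none ↔ m.minLinkCost r w ≤ c r
  /-- at `(A + B, w)`, place -/
  place_last : ∀ w, μ.act (m.A + m.B) w ≠ none
  /-- whenever a relay is placed, its power is a minimizer of `γ + ξout * Qout r γ w` -/
  power : ∀ r, m.A + 1 ≤ r → r ≤ m.A + m.B → ∀ w (γ : {γ : ℝ // γ ∈ m.powers}),
    μ.act r w = some γ → ∀ γ' ∈ m.powers, m.linkCost r γ w ≤ m.linkCost r γ' w

end StationaryPolicy

end PureAsYouGo

/-!
Walking one step is credited with a rate `lam`, and the relative value `value lam r` is defined by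
backward recursion from the distance `A + B`, where a relay must be placed. It depends continuously
on `lam`, so by the intermediate value theorem some `lam` makes the cycle from one node to the next
cost exactly zero relative to the credit (`Model.exists_optimal_rate`). For this `lam` the
optimality equation of the average-cost problem holds.

Let `S k` be the relative value of the current distance minus `lam` times the position, at the
instant `k`. Under any policy, `stageCost k + S (k + 1) - S k` is at least the minimum in the
optimality equation at the current state minus its mean (`Policy.bellman_sub_value_le`), with
equality for a threshold policy (`IsOptAsYouGo.stageCost_add_potential`). The lower bound has
expectation zero on the event that the position is at most `x`, since the state before the
measurement is independent of the shadowing about to be measured (`Policy.integral_state_eq_zero`).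
Summing over the instants at positions at most `x`, the increments of `S` telescope to `-lam * x`
up to a bounded error (`Policy.abs_sum_potential_add_le`). So the expected total cost up to `x` is
at least `lam * x` minus a constant under every policy, and at most `lam * x` plus a constant under
a threshold policy. The average cost of the latter is therefore `lam`, the least possible one.

Walking on from `r` has relative cost `value lam (r + 1) - lam`, which gives the thresholds; they
are nondecreasing because the hop costs are nondecreasing in the length of the link
(`Model.value_le_value_succ`).
-/

namespace PureAsYouGo

namespace Model

variable {𝒲 : Type*} [MeasurableSpace 𝒲]

instance (m : Model 𝒲) : IsProbabilityMeasure m.law := m.law_prob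

instance (m : Model 𝒲) : IsProbabilityMeasure m.pathMeasure := by
  unfold pathMeasure; infer_instance

/-! ### One-hop costs -/

/-- The least cost of placing a relay at the state `(r, w)`. -/
noncomputable def minHopCost (m : Model 𝒲) (r : ℕ) (w : 𝒲) : ℝ :=
  m.minLinkCost r w + m.ξrelay

/-- A uniform bound on the absolute values of all hop costs. -/
noncomputable def costBound (m : Model 𝒲) : ℝ :=
  ∑ γ ∈ m.powers, |γ| + m.ξout + m.ξrelay

lemma costBound_nonneg (m : Model 𝒲) : 0 ≤ m.costBound :=
  add_nonneg (add_nonneg (Finset.sum_nonneg fun _ _ => abs_nonneg _) m.ξout_nonneg)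
    m.ξrelay_nonneg

lemma abs_linkCost_add_le (m : Model 𝒲) {r : ℕ} (hr : 1 ≤ r) {γ : ℝ} (hγ : γ ∈ m.powers)
    (w : 𝒲) : |m.linkCost r γ w + m.ξrelay| ≤ m.costBound := by
  have h1 : |γ| ≤ ∑ γ ∈ m.powers, |γ| :=
    Finset.single_le_sum (f := fun γ => |γ|) (fun _ _ => abs_nonneg _) hγ
  have h2 := mul_nonneg m.ξout_nonneg (m.Qout_nonneg r hr γ hγ w)
  have h3 := mul_le_of_le_one_right m.ξout_nonneg (m.Qout_le_one r hr γ hγ w)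
  have h4 := m.ξrelay_nonneg
  have h5 := abs_le.1 h1
  unfold linkCost costBound
  rw [abs_le]
  constructor <;> linarith [m.ξout_nonneg]

lemma minLinkCost_le (m : Model 𝒲) (r : ℕ) {γ : ℝ} (hγ : γ ∈ m.powers) (w : 𝒲) :
    m.minLinkCost r w ≤ m.linkCost r γ w :=
  Finset.inf'_le _ hγ

lemma exists_linkCost_eq_min (m : Model 𝒲) (r : ℕ) (w : 𝒲) :
    ∃ γ ∈ m.powers, m.linkCost r γ w = m.minLinkCost r w := by
  obtain ⟨γ, hγ, h⟩ := Finset.exists_mem_eq_inf' m.powers_nonempty (fun γ => m.linkCost r γ w)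
  exact ⟨γ, hγ, h.symm⟩

lemma abs_minHopCost_le (m : Model 𝒲) {r : ℕ} (hr : 1 ≤ r) (w : 𝒲) :
    |m.minHopCost r w| ≤ m.costBound := by
  obtain ⟨γ, hγ, h⟩ := m.exists_linkCost_eq_min r w
  rw [minHopCost, ← h]
  exact m.abs_linkCost_add_le hr hγ w

lemma measurable_linkCost (m : Model 𝒲) {r : ℕ} (hr : 1 ≤ r) {γ : ℝ} (hγ : γ ∈ m.powers) :
    Measurable (m.linkCost r γ) :=
  ((m.Qout_measurable r hr γ hγ).const_mul _).const_add _

lemma measurable_minLinkCost (m : Model 𝒲) {r : ℕ} (hr : 1 ≤ r) :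
    Measurable (m.minLinkCost r) := by
  have h : Measurable (m.powers.inf' m.powers_nonempty fun γ => m.linkCost r γ) :=
    Finset.inf'_induction _ _ (fun _ hf _ hg => hf.inf hg)
      (fun γ hγ => m.measurable_linkCost hr hγ)
  convert h using 1
  ext w
  simp [minLinkCost, Finset.inf'_apply]

lemma measurable_minHopCost (m : Model 𝒲) {r : ℕ} (hr : 1 ≤ r) :
    Measurable (m.minHopCost r) :=
  (m.measurable_minLinkCost hr).add_const _

lemma minHopCost_mono (m : Model 𝒲) {r s : ℕ} (hr : 1 ≤ r) (hrs : r ≤ s) (w : 𝒲) :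
    m.minHopCost r w ≤ m.minHopCost s w := by
  obtain ⟨γ, hγ, h⟩ := m.exists_linkCost_eq_min s w
  rw [minHopCost, minHopCost, ← h]
  gcongr
  refine (m.minLinkCost_le r hγ w).trans ?_
  unfold linkCost
  gcongr
  · exact m.ξout_nonneg
  · exact m.Qout_mono γ hγ w hr (hr.trans hrs) hrs

/-! ### The relative value function -/

/-- The expected least relative cost, up to and including the next placement, when each step
walked is credited with `lam` and the relay must be placed within `n` further steps. The state is
the one before the shadowing at the current location is measured. -/
noncomputable def valueToGo (m : Model 𝒲) (lam : ℝ) : ℕ → ℝ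
  | 0 => ∫ w, m.minHopCost (m.A + m.B) w ∂m.law
  | n + 1 => ∫ w, min (m.minHopCost (m.A + m.B - (n + 1)) w) (m.valueToGo lam n - lam) ∂m.law

/-- `valueToGo` as a function of the distance `r` to the previous node. It is meaningful for
`r ≤ A + B` only. -/
noncomputable def value (m : Model 𝒲) (lam : ℝ) (r : ℕ) : ℝ :=
  m.valueToGo lam (m.A + m.B - r)

/-- The right-hand side of the optimality equation at the state `(r, w)`: the better of placing a
relay and walking on, where walking on is ruled out at the distance `A + B`. -/
noncomputable def bellman (m : Model 𝒲) (lam : ℝ) (r : ℕ) (w : 𝒲) : ℝ :=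
  if r < m.A + m.B then min (m.minHopCost r w) (m.value lam (r + 1) - lam) else m.minHopCost r w

lemma integral_bellman (m : Model 𝒲) (lam : ℝ) {r : ℕ} (hr : r ≤ m.A + m.B) :
    ∫ w, m.bellman lam r w ∂m.law = m.value lam r := by
  rcases hr.lt_or_eq with h | rfl
  · obtain ⟨n, hn⟩ : ∃ n, m.A + m.B - r = n + 1 := ⟨m.A + m.B - r - 1, by omega⟩
    have e1 : m.A + m.B - (n + 1) = r := by omega
    have e2 : m.A + m.B - (r + 1) = n := by omega
    simp only [bellman, if_pos h, value, hn, valueToGo, e1, e2]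
  · simp [bellman, value, valueToGo]

lemma measurable_bellman (m : Model 𝒲) (lam : ℝ) {r : ℕ} (hr : 1 ≤ r) :
    Measurable (m.bellman lam r) := by
  unfold bellman
  split_ifs
  · exact (m.measurable_minHopCost hr).min measurable_const
  · exact m.measurable_minHopCost hr

lemma abs_bellman_le (m : Model 𝒲) (lam : ℝ) {r : ℕ} (hr : 1 ≤ r) (w : 𝒲) :
    |m.bellman lam r w| ≤ m.costBound + |m.value lam (r + 1) - lam| := by
  have h := m.abs_minHopCost_le hr w
  unfold bellman
  split_ifs
  · refine abs_min_le_max_abs_abs.trans (max_le ?_ ?_)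
    · linarith [abs_nonneg (m.value lam (r + 1) - lam)]
    · linarith [m.costBound_nonneg]
  · linarith [abs_nonneg (m.value lam (r + 1) - lam)]

lemma integrable_bellman (m : Model 𝒲) (lam : ℝ) {r : ℕ} (hr : 1 ≤ r) :
    Integrable (m.bellman lam r) m.law :=
  .of_bound (m.measurable_bellman lam hr).aestronglyMeasurable _
    (.of_forall fun w => m.abs_bellman_le lam hr w)

lemma integrable_minHopCost (m : Model 𝒲) {r : ℕ} (hr : 1 ≤ r) :
    Integrable (m.minHopCost r) m.law :=
  .of_bound (m.measurable_minHopCost hr).aestronglyMeasurable _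
    (.of_forall fun w => m.abs_minHopCost_le hr w)

/-- The relative value is nondecreasing in the distance because the hop costs are; this is where
the thresholds get their monotonicity. -/
lemma value_le_value_succ (m : Model 𝒲) (lam : ℝ) {r : ℕ} (hr : 1 ≤ r) (h : r < m.A + m.B) :
    m.value lam r ≤ m.value lam (r + 1) := by
  obtain ⟨n, hn⟩ : ∃ n, m.A + m.B = r + 1 + n := ⟨m.A + m.B - (r + 1), by omega⟩
  induction n generalizing r with
  | zero =>
    rw [← m.integral_bellman lam h.le, ← m.integral_bellman lam h]
    refine integral_mono (m.integrable_bellman lam hr) (m.integrable_bellman lam (by omega)) ?_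
    intro w
    simp only [bellman, if_pos h, if_neg (show ¬ r + 1 < m.A + m.B by omega)]
    exact (min_le_left _ _).trans (m.minHopCost_mono hr r.le_succ w)
  | succ n ih =>
    have h' : r + 1 < m.A + m.B := by omega
    have := ih (r := r + 1) (by omega) h' (by omega)
    rw [← m.integral_bellman lam h.le, ← m.integral_bellman lam h]
    refine integral_mono (m.integrable_bellman lam hr) (m.integrable_bellman lam (by omega)) ?_
    intro w
    simp only [bellman, if_pos h, if_pos h']
    exact min_le_min (m.minHopCost_mono hr r.le_succ w) (by linarith)

lemma value_le_costBound (m : Model 𝒲) (lam : ℝ) {r : ℕ} (hr : 1 ≤ r) (h : r ≤ m.A + m.B) :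
    m.value lam r ≤ m.costBound := by
  rw [← m.integral_bellman lam h]
  refine (integral_mono (m.integrable_bellman lam hr) (integrable_const m.costBound) ?_).trans
    (by simp)
  intro w
  have := (abs_le.1 (m.abs_minHopCost_le hr w)).2
  simp only [bellman]
  split_ifs
  · exact (min_le_left _ _).trans this
  · exact this

lemma neg_costBound_le_value (m : Model 𝒲) {lam : ℝ} (hlam : lam ≤ 0) {r : ℕ} (hr : 1 ≤ r)
    (h : r ≤ m.A + m.B) : -m.costBound ≤ m.value lam r := by
  obtain ⟨n, hn⟩ : ∃ n, m.A + m.B = r + n := ⟨m.A + m.B - r, by omega⟩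
  induction n generalizing r with
  | zero =>
    rw [← m.integral_bellman lam h]
    refine le_trans (by simp) (integral_mono (integrable_const (-m.costBound))
      (m.integrable_bellman lam hr) ?_)
    intro w
    simp only [bellman, if_neg (show ¬ r < m.A + m.B by omega)]
    exact (abs_le.1 (m.abs_minHopCost_le hr w)).1
  | succ n ih =>
    have := ih (r := r + 1) (by omega) (by omega) (by omega)
    rw [← m.integral_bellman lam h]
    refine le_trans (by simp) (integral_mono (integrable_const (-m.costBound))
      (m.integrable_bellman lam hr) ?_)
    intro w
    simp only [bellman, if_pos (show r < m.A + m.B by omega)]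
    exact le_min (abs_le.1 (m.abs_minHopCost_le hr w)).1 (by linarith)

lemma continuous_integral_min_const {Ω : Type*} [MeasurableSpace Ω] {μ : Measure Ω}
    [IsProbabilityMeasure μ] {F : Ω → ℝ} (hF : Integrable F μ) :
    Continuous fun t : ℝ => ∫ w, min (F w) t ∂μ := by
  refine (LipschitzWith.of_dist_le' (K := 1) fun s t => ?_).continuous
  have hi : ∀ t : ℝ, Integrable (fun w => min (F w) t) μ :=
    fun t => hF.inf (integrable_const t)
  rw [Real.dist_eq, Real.dist_eq, ← integral_sub (hi s) (hi t), one_mul]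
  have h : ∀ w, ‖min (F w) s - min (F w) t‖ ≤ |s - t| := fun w => by
    simpa using abs_min_sub_min_le_max (F w) s (F w) t
  simpa using norm_integral_le_of_norm_le_const (μ := μ) (.of_forall h)

lemma continuous_value (m : Model 𝒲) {r : ℕ} (hr : 1 ≤ r) (h : r ≤ m.A + m.B) :
    Continuous fun lam => m.value lam r := by
  obtain ⟨n, hn⟩ : ∃ n, m.A + m.B = r + n := ⟨m.A + m.B - r, by omega⟩
  induction n generalizing r with
  | zero =>
    have : r = m.A + m.B := by omega
    subst this
    simp only [value, Nat.sub_self, valueToGo]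
    exact continuous_const
  | succ n ih =>
    have := ih (r := r + 1) (by omega) (by omega) (by omega)
    simp_rw [← m.integral_bellman _ h, bellman, if_pos (show r < m.A + m.B by omega)]
    exact (continuous_integral_min_const (m.integrable_minHopCost hr)).comp
      (this.sub continuous_id)

/-- The optimality equation has a solution: for some `lam`, which turns out to be the optimal
average cost, the renewal cycle from one node to the next has relative cost zero. -/
lemma exists_optimal_rate (m : Model 𝒲) :
    ∃ lam : ℝ, m.value lam (m.A + 1) = lam * (m.A + 1 : ℕ) := by
  have hB := m.B_pos
  have hC := m.costBound_nonneg
  have hr : 1 ≤ m.A + 1 := by omega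
  have hle : m.A + 1 ≤ m.A + m.B := by omega
  have hA : m.costBound ≤ m.costBound * (m.A + 1 : ℕ) :=
    le_mul_of_one_le_right hC (by exact_mod_cast hr)
  have hcont : Continuous fun lam : ℝ => m.value lam (m.A + 1) - lam * (m.A + 1 : ℕ) :=
    (m.continuous_value hr hle).sub (continuous_id.mul continuous_const)
  have h0 : (0 : ℝ) ∈ Set.Icc (m.value m.costBound (m.A + 1) - m.costBound * (m.A + 1 : ℕ))
      (m.value (-m.costBound) (m.A + 1) - -m.costBound * (m.A + 1 : ℕ)) := by
    have h1 := m.value_le_costBound m.costBound hr hle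
    have h2 := m.neg_costBound_le_value (neg_nonpos.2 hC) hr hle
    constructor <;> linarith
  obtain ⟨lam, -, h⟩ := intermediate_value_Icc' (neg_le_self hC) hcont.continuousOn h0
  exact ⟨lam, by linarith [h]⟩

end Model

namespace Policy

variable {𝒲 : Type*} [MeasurableSpace 𝒲] {m : Model 𝒲}

/-! ### Dynamics under a policy -/

lemma dist_succ (π : Policy m) (ω : Model.Path 𝒲) (k : ℕ) :
    π.dist ω (k + 1) = if π.actAt ω k (π.dist ω k) = none then π.dist ω k + 1 else m.A + 1 := by
  rw [dist]
  cases π.actAt ω k (π.dist ω k) <;> simp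

lemma pos_succ (π : Policy m) (ω : Model.Path 𝒲) (k : ℕ) :
    π.pos ω (k + 1) = π.pos ω k + if π.actAt ω k (π.dist ω k) = none then 1 else m.A + 1 := by
  rw [pos]
  cases π.actAt ω k (π.dist ω k) <;> simp

lemma dist_mem (π : Policy m) (ω : Model.Path 𝒲) (k : ℕ) :
    π.dist ω k ∈ Finset.Icc (m.A + 1) (m.A + m.B) := by
  have hB := m.B_pos
  rw [Finset.mem_Icc]
  induction k with
  | zero => simp [dist, hB]
  | succ k ih =>
    rw [dist_succ]
    split_ifs with h
    · have : π.dist ω k ≠ m.A + m.B := fun e =>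
        π.must_place k (fun i => ω i) (by rw [← e]; exact h)
      omega
    · omega

lemma pos_lt_pos_succ (π : Policy m) (ω : Model.Path 𝒲) (k : ℕ) :
    π.pos ω k < π.pos ω (k + 1) := by
  rw [pos_succ]; split_ifs <;> omega

lemma strictMono_pos (π : Policy m) (ω : Model.Path 𝒲) : StrictMono (π.pos ω) :=
  strictMono_nat_of_lt_succ (π.pos_lt_pos_succ ω)

lemma lt_pos (π : Policy m) (ω : Model.Path 𝒲) (k : ℕ) : k < π.pos ω k := by
  induction k with
  | zero => simp [pos]
  | succ k ih => exact lt_of_le_of_lt ih (π.pos_lt_pos_succ ω k)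

/-- The position and the distance at the instant `k` depend on the observations before `k` only. -/
lemma dist_pos_congr (π : Policy m) {ω ω' : Model.Path 𝒲} {k : ℕ} (h : ∀ i < k, ω i = ω' i) :
    π.dist ω k = π.dist ω' k ∧ π.pos ω k = π.pos ω' k := by
  induction k with
  | zero => simp [dist, pos]
  | succ k ih =>
    obtain ⟨h1, h2⟩ := ih fun i hi => h i (by omega)
    have h3 : ∀ r, π.actAt ω k r = π.actAt ω' k r := fun r => by
      unfold actAt
      congr 1
      ext1 i
      exact h i i.2
    simp only [dist_succ, pos_succ, h1, h2, h3, and_self]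

/-! ### Measurability -/

lemma measurableSet_actAt (π : Policy m) (k r : ℕ) (a : m.Action) :
    MeasurableSet {ω | π.actAt ω k r = a} :=
  (measurable_pi_lambda (fun (ω : Model.Path 𝒲) (i : Fin (k + 1)) => ω i)
    fun _ => measurable_pi_apply _) (π.measurable_act k r a)

lemma measurableSet_actAt_comp (π : Policy m) {k : ℕ} {d : Model.Path 𝒲 → ℕ} (hd : Measurable d)
    (a : m.Action) : MeasurableSet {ω | π.actAt ω k (d ω) = a} := by
  have : {ω | π.actAt ω k (d ω) = a} = ⋃ r, d ⁻¹' {r} ∩ {ω | π.actAt ω k r = a} := by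
    ext ω
    simp
  rw [this]
  exact .iUnion fun r => (hd (measurableSet_singleton r)).inter (π.measurableSet_actAt k r a)

lemma measurable_dist (π : Policy m) (k : ℕ) : Measurable fun ω => π.dist ω k := by
  induction k with
  | zero => exact measurable_const
  | succ k ih =>
    simp only [dist_succ]
    exact .ite (π.measurableSet_actAt_comp ih none) (ih.add_const 1) measurable_const

lemma measurable_pos (π : Policy m) (k : ℕ) : Measurable fun ω => π.pos ω k := by
  induction k with
  | zero => exact measurable_const
  | succ k ih =>
    simp only [pos_succ]
    exact ih.add (.ite (π.measurableSet_actAt_comp (π.measurable_dist k) none) measurable_const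
      measurable_const)

lemma stageCost_eq_sum (π : Policy m) (ω : Model.Path 𝒲) (k : ℕ) :
    π.stageCost ω k = ∑ r ∈ Finset.Icc (m.A + 1) (m.A + m.B), ∑ γ : {γ : ℝ // γ ∈ m.powers},
      {ω | π.dist ω k = r ∧ π.actAt ω k r = some γ}.indicator
        (fun ω => m.linkCost r γ (ω k).1 + m.ξrelay) ω := by
  rw [Finset.sum_eq_single_of_mem _ (π.dist_mem ω k)]
  · unfold stageCost
    cases h : π.actAt ω k (π.dist ω k) with
    | none => simp [h]
    | some γ => simp [Set.indicator_apply, h]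
  · intro r _ hr
    simp [hr.symm]

lemma measurable_stageCost (π : Policy m) (k : ℕ) : Measurable fun ω => π.stageCost ω k := by
  simp only [stageCost_eq_sum]
  refine Finset.measurable_sum _ fun r hr => Finset.measurable_sum _ fun γ _ => ?_
  have hr1 : 1 ≤ r := by have := Finset.mem_Icc.1 hr; omega
  refine Measurable.indicator ?_ ?_
  · exact ((m.measurable_linkCost hr1 γ.2).comp
      (measurable_fst.comp (measurable_pi_apply k))).add_const _
  · exact (π.measurable_dist k (measurableSet_singleton r)).inter (π.measurableSet_actAt k r _)

lemma abs_stageCost_le (π : Policy m) (ω : Model.Path 𝒲) (k : ℕ) :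
    |π.stageCost ω k| ≤ m.costBound := by
  have hr1 : 1 ≤ π.dist ω k := by have := Finset.mem_Icc.1 (π.dist_mem ω k); omega
  unfold stageCost
  split
  · simpa using m.costBound_nonneg
  · exact m.abs_linkCost_add_le hr1 (Subtype.prop _) _

lemma integrable_totalCost (π : Policy m) (x : ℕ) :
    Integrable (π.totalCost x) m.pathMeasure := by
  unfold totalCost
  refine integrable_finsetSum _ fun k _ => ?_
  refine .of_bound (C := m.costBound) (Measurable.aestronglyMeasurable ?_) (.of_forall fun ω => ?_)
  · exact .ite (π.measurable_pos k measurableSet_Iic) (π.measurable_stageCost k) measurable_const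
  · split_ifs
    · exact π.abs_stageCost_le ω k
    · simpa using m.costBound_nonneg

/-! ### The fresh shadowing is independent of the past -/

/-- A function of the state whose mean over the shadowing vanishes has mean zero at the instant `k`,
also when restricted to the event that the location `x` has not been passed: position and distance
are determined before the shadowing is measured. -/
lemma integral_state_eq_zero (π : Policy m) (x k : ℕ) {u : ℕ → 𝒲 → ℝ}
    (hu : ∀ r ∈ Finset.Icc (m.A + 1) (m.A + m.B), Integrable (u r) m.law)
    (hu0 : ∀ r ∈ Finset.Icc (m.A + 1) (m.A + m.B), ∫ w, u r w ∂m.law = 0) :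
    Integrable (fun ω => if π.pos ω k ≤ x then u (π.dist ω k) (ω k).1 else 0) m.pathMeasure ∧
    ∫ ω, (if π.pos ω k ≤ x then u (π.dist ω k) (ω k).1 else 0) ∂m.pathMeasure = 0 := by
  have hmp : MeasurePreserving (fun ω : Model.Path 𝒲 => (ω k).1) m.pathMeasure m.law :=
    measurePreserving_fst.comp
      (measurePreserving_eval_infinitePi (fun _ : ℕ => m.law.prod (volume : Measure unitInterval))
        k)
  -- Split according to the value of the distance.
  have hsum : (fun ω : Model.Path 𝒲 => if π.pos ω k ≤ x then u (π.dist ω k) (ω k).1 else 0) =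
      fun ω => ∑ r ∈ Finset.Icc (m.A + 1) (m.A + m.B),
        (if π.pos ω k ≤ x ∧ π.dist ω k = r then (1 : ℝ) else 0) * u r (ω k).1 := by
    ext ω
    rw [Finset.sum_eq_single_of_mem _ (π.dist_mem ω k)]
    · simp
    · intro r _ hr
      simp [hr.symm]
  have hmeas : ∀ r, MeasurableSet {ω : Model.Path 𝒲 | π.pos ω k ≤ x ∧ π.dist ω k = r} :=
    fun r => (π.measurable_pos k measurableSet_Iic).inter
      (π.measurable_dist k (measurableSet_singleton r))
  have hmeas1 : ∀ r, Measurable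
      fun ω : Model.Path 𝒲 => if π.pos ω k ≤ x ∧ π.dist ω k = r then (1 : ℝ) else 0 :=
    fun r => .ite (hmeas r) measurable_const measurable_const
  have hint : ∀ r ∈ Finset.Icc (m.A + 1) (m.A + m.B), Integrable
      (fun ω => (if π.pos ω k ≤ x ∧ π.dist ω k = r then (1 : ℝ) else 0) * u r (ω k).1)
      m.pathMeasure := fun r hr =>
    (hmp.integrable_comp_of_integrable (hu r hr)).bdd_mul (c := 1)
      (hmeas1 r).aestronglyMeasurable (.of_forall fun ω => by split_ifs <;> simp)
  rw [hsum]
  refine ⟨integrable_finsetSum _ hint, ?_⟩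
  rw [integral_finsetSum _ hint]
  refine Finset.sum_eq_zero fun r hr => ?_
  have : Nonempty 𝒲 := nonempty_of_isProbabilityMeasure m.law
  let w₀ : Model.Obs 𝒲 := Classical.arbitrary _
  -- The path with the given observations before `k` and constant from `k` on.
  let fill : (Finset.range k → Model.Obs 𝒲) → Model.Path 𝒲 :=
    fun p i => if h : i ∈ Finset.range k then p ⟨i, h⟩ else w₀
  have hfill : Measurable fill := measurable_pi_lambda _ fun i => by
    by_cases h : i ∈ Finset.range k
    · simpa only [fill, h, dite_true] using measurable_pi_apply _
    · simpa only [fill, h, dite_false] using measurable_const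
  have hind : ProbabilityTheory.iIndepFun (fun (i : ℕ) (ω : Model.Path 𝒲) => ω i)
      m.pathMeasure :=
    ProbabilityTheory.iIndepFun_infinitePi (X := fun _ => id) fun _ => measurable_id
  have hind2 := (hind.indepFun_finset (Finset.range k) {k} (by simp) measurable_pi_apply).comp
    (φ := fun p => if π.pos (fill p) k ≤ x ∧ π.dist (fill p) k = r then (1 : ℝ) else 0)
    (ψ := fun p => (p ⟨k, by simp⟩).1) ((hmeas1 r).comp hfill)
    (measurable_fst.comp (measurable_pi_apply _))
  have hpast : (fun ω : Model.Path 𝒲 =>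
      if π.pos ω k ≤ x ∧ π.dist ω k = r then (1 : ℝ) else 0) =
      (fun p => if π.pos (fill p) k ≤ x ∧ π.dist (fill p) k = r then (1 : ℝ) else 0) ∘
        fun (ω : Model.Path 𝒲) (i : Finset.range k) => ω i := by
    ext ω
    have := π.dist_pos_congr (ω := ω) (ω' := fill fun i : Finset.range k => ω i) (k := k)
      fun i hi => by simp [fill, hi]
    simp [this.1, this.2]
  rw [← hpast] at hind2
  have := hind2.integral_fun_comp_mul_comp (f := id) (g := u r)
    (hmeas1 r).aemeasurable hmp.measurable.aemeasurable
    aestronglyMeasurable_id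
    (by
      have := (hu r hr).aestronglyMeasurable
      rw [← hmp.map_eq] at this
      exact this)
  refine this.trans ?_
  have h0 : ∫ ω, u r (ω k).1 ∂m.pathMeasure = 0 := by
    rw [← hu0 r hr, ← hmp.map_eq, integral_map hmp.measurable.aemeasurable]
    rw [hmp.map_eq]
    exact (hu r hr).aestronglyMeasurable
  exact mul_eq_zero_of_right _ h0

/-! ### The potential and its increments -/

/-- Relative value of the current distance minus the credit for the ground covered so far. -/
noncomputable def potential (π : Policy m) (lam : ℝ) (ω : Model.Path 𝒲) (k : ℕ) : ℝ :=
  m.value lam (π.dist ω k) - lam * π.pos ω k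

/-- The excess of the optimality equation over its mean, at the state reached at the instant `k`,
is at most the stage cost plus the increment of the potential. -/
lemma bellman_sub_value_le (π : Policy m) {lam : ℝ}
    (hlam : m.value lam (m.A + 1) = lam * (m.A + 1 : ℕ)) (ω : Model.Path 𝒲) (k : ℕ) :
    m.bellman lam (π.dist ω k) (ω k).1 - m.value lam (π.dist ω k) ≤
      π.stageCost ω k + (π.potential lam ω (k + 1) - π.potential lam ω k) := by
  have hd := Finset.mem_Icc.1 (π.dist_mem ω k)
  have hd' := Finset.mem_Icc.1 (π.dist_mem ω (k + 1))
  unfold potential Model.bellman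
  rw [dist_succ] at hd' ⊢
  rw [pos_succ]
  unfold stageCost
  cases h : π.actAt ω k (π.dist ω k) with
  | none =>
    simp only [h, if_true] at hd' ⊢
    rw [if_pos (by omega)]
    have := min_le_right (m.minHopCost (π.dist ω k) (ω k).1)
      (m.value lam (π.dist ω k + 1) - lam)
    push_cast
    linarith
  | some γ =>
    have h1 := m.minLinkCost_le (π.dist ω k) γ.2 (ω k).1
    have h2 : (if π.dist ω k < m.A + m.B then min (m.minHopCost (π.dist ω k) (ω k).1)
        (m.value lam (π.dist ω k + 1) - lam) else m.minHopCost (π.dist ω k) (ω k).1) ≤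
        m.minHopCost (π.dist ω k) (ω k).1 := by
      split_ifs
      · exact min_le_left _ _
      · exact le_rfl
    simp only [reduceCtorEq, if_false, hlam]
    unfold Model.minHopCost at h2
    unfold Model.minHopCost
    push_cast at h2 ⊢
    linarith

/-- Only the instants at positions at most `x` count, and these are an initial segment of the
instants; the increments of the potential over it telescope. -/
lemma exists_sum_potential_eq (π : Policy m) (lam : ℝ) (ω : Model.Path 𝒲) (x : ℕ) :
    ∃ j, x < π.pos ω j ∧ π.pos ω j ≤ x + (m.A + 1) ∧
      ∑ k ∈ Finset.range x, (if π.pos ω k ≤ x then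
        π.potential lam ω (k + 1) - π.potential lam ω k else 0) =
      π.potential lam ω j - π.potential lam ω 0 := by
  have key : ∀ n, ∃ j ≤ n, (j = n ∨ x < π.pos ω j) ∧ π.pos ω j ≤ x + (m.A + 1) ∧
      ∑ k ∈ Finset.range n, (if π.pos ω k ≤ x then
        π.potential lam ω (k + 1) - π.potential lam ω k else 0) =
      π.potential lam ω j - π.potential lam ω 0 := by
    intro n
    induction n with
    | zero => exact ⟨0, le_rfl, .inl rfl, by simp [pos], by simp⟩
    | succ n ih =>
      obtain ⟨j, hj, h1, h2, h3⟩ := ih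
      rw [Finset.sum_range_succ, h3]
      have hmono := (π.strictMono_pos ω).monotone hj
      by_cases hn : π.pos ω n ≤ x
      · obtain rfl : j = n := h1.resolve_right (by omega)
        refine ⟨j + 1, le_rfl, .inl rfl, ?_, by rw [if_pos hn]; ring⟩
        rw [pos_succ]
        split_ifs <;> omega
      · refine ⟨j, by omega, .inr ?_, h2, by rw [if_neg hn, add_zero]⟩
        rcases h1 with rfl | h1 <;> omega
  obtain ⟨j, -, h1, h2, h3⟩ := key x
  refine ⟨j, ?_, h2, h3⟩
  rcases h1 with rfl | h1
  · exact π.lt_pos ω j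
  · exact h1

end Policy

namespace Model

variable {𝒲 : Type*} [MeasurableSpace 𝒲]

/-- A bound on the difference between the total cost up to `x` and `lam * x` that comes from the
boundary terms of the telescoping sum. -/
noncomputable def gapBound (m : Model 𝒲) (lam : ℝ) : ℝ :=
  ∑ r ∈ Finset.range (m.A + m.B + 1), |m.value lam r| + |lam| * (m.A + 1 : ℕ)

end Model

namespace Policy

variable {𝒲 : Type*} [MeasurableSpace 𝒲] {m : Model 𝒲}

lemma abs_sum_potential_add_le (π : Policy m) {lam : ℝ}
    (hlam : m.value lam (m.A + 1) = lam * (m.A + 1 : ℕ)) (ω : Model.Path 𝒲) (x : ℕ) :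
    |∑ k ∈ Finset.range x, (if π.pos ω k ≤ x then
        π.potential lam ω (k + 1) - π.potential lam ω k else 0) + lam * x| ≤ m.gapBound lam := by
  obtain ⟨j, h1, h2, h3⟩ := π.exists_sum_potential_eq lam ω x
  have h0 : π.potential lam ω 0 = 0 := by simp [potential, dist, pos, hlam]
  rw [h3, h0, potential]
  have hd := Finset.mem_Icc.1 (π.dist_mem ω j)
  have hv : |m.value lam (π.dist ω j)| ≤
      ∑ r ∈ Finset.range (m.A + m.B + 1), |m.value lam r| :=
    Finset.single_le_sum (f := fun r => |m.value lam r|) (fun _ _ => abs_nonneg _)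
      (Finset.mem_range.2 (by omega))
  have hp : |lam * ((π.pos ω j : ℝ) - x)| ≤ |lam| * (m.A + 1 : ℕ) := by
    rw [abs_mul]
    gcongr
    have h1' : (x : ℝ) < π.pos ω j := by exact_mod_cast h1
    have h2' : (π.pos ω j : ℝ) ≤ x + (m.A + 1 : ℕ) := by exact_mod_cast h2
    rw [abs_le]
    constructor <;> linarith
  calc _ = |m.value lam (π.dist ω j) - lam * ((π.pos ω j : ℝ) - x)| := by congr 1; ring
    _ ≤ _ := abs_sub _ _
    _ ≤ _ := add_le_add hv hp

/-- The sum of the centred terms of the optimality equation up to the location `x`. -/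
noncomputable def centredSum (π : Policy m) (lam : ℝ) (x : ℕ) (ω : Model.Path 𝒲) : ℝ :=
  ∑ k ∈ Finset.range x, if π.pos ω k ≤ x then
    m.bellman lam (π.dist ω k) (ω k).1 - m.value lam (π.dist ω k) else 0

lemma integral_centredSum (π : Policy m) (lam : ℝ) (x : ℕ) :
    Integrable (π.centredSum lam x) m.pathMeasure ∧
    ∫ ω, π.centredSum lam x ω ∂m.pathMeasure = 0 := by
  have h := fun k => π.integral_state_eq_zero x k
    (u := fun r w => m.bellman lam r w - m.value lam r)
    (fun r hr => (m.integrable_bellman lam (by have := Finset.mem_Icc.1 hr; omega)).sub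
      (integrable_const _))
    (fun r hr => by
      have := Finset.mem_Icc.1 hr
      rw [integral_sub (m.integrable_bellman lam (by omega)) (integrable_const _),
        m.integral_bellman lam this.2]
      simp)
  unfold centredSum
  refine ⟨integrable_finsetSum _ fun k _ => (h k).1, ?_⟩
  rw [integral_finsetSum _ fun k _ => (h k).1]
  exact Finset.sum_eq_zero fun k _ => (h k).2

/-- No policy beats the rate `lam` by more than a bounded amount. -/
lemma le_integral_totalCost (π : Policy m) {lam : ℝ}
    (hlam : m.value lam (m.A + 1) = lam * (m.A + 1 : ℕ)) (x : ℕ) :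
    lam * x - m.gapBound lam ≤ ∫ ω, π.totalCost x ω ∂m.pathMeasure := by
  obtain ⟨hi, h0⟩ := π.integral_centredSum lam x
  have h : ∀ ω, π.centredSum lam x ω + (lam * x - m.gapBound lam) ≤ π.totalCost x ω := fun ω => by
    have h1 := (abs_le.1 (π.abs_sum_potential_add_le hlam ω x)).2
    have h2 : π.centredSum lam x ω ≤ π.totalCost x ω + ∑ k ∈ Finset.range x,
        (if π.pos ω k ≤ x then π.potential lam ω (k + 1) - π.potential lam ω k else 0) := by
      rw [centredSum, totalCost, ← Finset.sum_add_distrib]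
      refine Finset.sum_le_sum fun k _ => ?_
      split_ifs
      · exact π.bellman_sub_value_le hlam ω k
      · simp
    linarith
  have := integral_mono (hi.add (integrable_const _)) (π.integrable_totalCost x) h
  rw [integral_add' hi (integrable_const _), h0] at this
  simpa using this

/-- A policy whose actions attain the minimum in the optimality equation has the rate `lam` up to
a bounded amount. -/
lemma integral_totalCost_le (π : Policy m) {lam : ℝ}
    (hlam : m.value lam (m.A + 1) = lam * (m.A + 1 : ℕ))
    (hπ : ∀ ω k, π.stageCost ω k + (π.potential lam ω (k + 1) - π.potential lam ω k) =
      m.bellman lam (π.dist ω k) (ω k).1 - m.value lam (π.dist ω k)) (x : ℕ) :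
    ∫ ω, π.totalCost x ω ∂m.pathMeasure ≤ lam * x + m.gapBound lam := by
  obtain ⟨hi, h0⟩ := π.integral_centredSum lam x
  have h : ∀ ω, π.totalCost x ω ≤ π.centredSum lam x ω + (lam * x + m.gapBound lam) := fun ω => by
    have h1 := (abs_le.1 (π.abs_sum_potential_add_le hlam ω x)).1
    have h2 : π.centredSum lam x ω = π.totalCost x ω + ∑ k ∈ Finset.range x,
        (if π.pos ω k ≤ x then π.potential lam ω (k + 1) - π.potential lam ω k else 0) := by
      rw [centredSum, totalCost, ← Finset.sum_add_distrib]
      refine Finset.sum_congr rfl fun k _ => ?_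
      split_ifs
      · exact (hπ ω k).symm
      · simp
    linarith
  have := integral_mono (π.integrable_totalCost x) (hi.add (integrable_const _)) h
  rw [integral_add' hi (integrable_const _), h0] at this
  simpa using this

lemma le_avgCost (π : Policy m) {lam : ℝ}
    (hlam : m.value lam (m.A + 1) = lam * (m.A + 1 : ℕ)) : (lam : EReal) ≤ π.avgCost := by
  have hlim : Tendsto (fun x : ℕ => ((lam - m.gapBound lam / x : ℝ) : EReal)) atTop
      (nhds (lam : EReal)) := by
    refine (continuous_coe_real_ereal.tendsto lam).comp ?_
    simpa using tendsto_const_nhds.sub (tendsto_const_div_atTop_nhds_zero_nat (m.gapBound lam))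
  rw [← hlim.limsup_eq]
  refine limsup_le_limsup ?_
  filter_upwards [eventually_gt_atTop 0] with x hx
  have hx' : (0 : ℝ) < x := by exact_mod_cast hx
  rw [EReal.coe_le_coe_iff, le_div_iff₀ hx', sub_mul, div_mul_cancel₀ _ hx'.ne']
  exact π.le_integral_totalCost hlam x

lemma avgCost_le (π : Policy m) {lam : ℝ}
    (hlam : m.value lam (m.A + 1) = lam * (m.A + 1 : ℕ))
    (hπ : ∀ ω k, π.stageCost ω k + (π.potential lam ω (k + 1) - π.potential lam ω k) =
      m.bellman lam (π.dist ω k) (ω k).1 - m.value lam (π.dist ω k)) :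
    π.avgCost ≤ (lam : EReal) := by
  have hlim : Tendsto (fun x : ℕ => ((lam + m.gapBound lam / x : ℝ) : EReal)) atTop
      (nhds (lam : EReal)) := by
    refine (continuous_coe_real_ereal.tendsto lam).comp ?_
    simpa using tendsto_const_nhds.add (tendsto_const_div_atTop_nhds_zero_nat (m.gapBound lam))
  rw [← hlim.limsup_eq]
  refine limsup_le_limsup ?_
  filter_upwards [eventually_gt_atTop 0] with x hx
  have hx' : (0 : ℝ) < x := by exact_mod_cast hx
  rw [EReal.coe_le_coe_iff, div_le_iff₀ hx', add_mul, div_mul_cancel₀ _ hx'.ne']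
  exact π.integral_totalCost_le hlam hπ x

end Policy

/-! ### The threshold policy -/

namespace Model

variable {𝒲 : Type*} [MeasurableSpace 𝒲]

/-- The threshold at the distance `r`: placing costs at most as much as walking on iff the least
link cost is at most this number. -/
noncomputable def threshold (m : Model 𝒲) (lam : ℝ) (r : ℕ) : ℝ :=
  m.value lam (r + 1) - lam - m.ξrelay

lemma monotoneOn_threshold (m : Model 𝒲) (lam : ℝ) :
    MonotoneOn (m.threshold lam) (Set.Ico (m.A + 1) (m.A + m.B)) := by
  refine monotoneOn_of_le_add_one Set.ordConnected_Ico fun r _ _ hr => ?_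
  have := m.value_le_value_succ lam (r := r + 1) (by omega) hr.2
  unfold threshold
  linarith

/-- Ties between the minimizing powers are broken in favour of the smallest one; this determines
the power and so makes the choice measurable. -/
lemma exists_measurable_argmin (m : Model 𝒲) {r : ℕ} (hr : 1 ≤ r) :
    ∃ g : 𝒲 → {γ : ℝ // γ ∈ m.powers}, (∀ γ, MeasurableSet {w | g w = γ}) ∧
      ∀ w, ∀ γ ∈ m.powers, m.linkCost r (g w) w ≤ m.linkCost r γ w := by
  let P : 𝒲 → {γ : ℝ // γ ∈ m.powers} → Prop := fun w γ =>
    m.linkCost r γ w = m.minLinkCost r w ∧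
      ∀ γ' : {γ : ℝ // γ ∈ m.powers}, m.linkCost r γ' w = m.minLinkCost r w → γ ≤ γ'
  have hex : ∀ w, ∃ γ, P w γ := fun w => by
    obtain ⟨γ, hγ, h⟩ := m.exists_linkCost_eq_min r w
    obtain ⟨γ₀, h1, h2⟩ := Set.exists_min_image
      {γ : {γ : ℝ // γ ∈ m.powers} | m.linkCost r γ w = m.minLinkCost r w} id
      (Set.toFinite _) ⟨⟨γ, hγ⟩, h⟩
    exact ⟨γ₀, h1, h2⟩
  choose g hg using hex
  have hmeas : ∀ γ : {γ : ℝ // γ ∈ m.powers},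
      MeasurableSet {w | m.linkCost r γ w = m.minLinkCost r w} := fun γ =>
    measurableSet_eq_fun (m.measurable_linkCost hr γ.2) (m.measurable_minLinkCost hr)
  refine ⟨g, fun γ => ?_, fun w γ hγ => (hg w).1.trans_le (m.minLinkCost_le r hγ w)⟩
  have : {w | g w = γ} = {w | m.linkCost r γ w = m.minLinkCost r w} ∩
      ⋂ γ' : {γ : ℝ // γ ∈ m.powers},
        ({w | m.linkCost r γ' w = m.minLinkCost r w}ᶜ ∪ {_w | γ ≤ γ'}) := by
    ext w
    simp only [Set.mem_inter_iff, Set.mem_iInter, Set.mem_union, Set.mem_compl_iff,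
      Set.mem_ofPred_eq, ← imp_iff_not_or]
    exact ⟨fun h => h ▸ hg w, fun h => le_antisymm ((hg w).2 γ h.1) (h.2 _ (hg w).1)⟩
  rw [this]
  exact (hmeas γ).inter (.iInter fun γ' => (hmeas γ').compl.union (.const _))

end Model

namespace StationaryPolicy

variable {𝒲 : Type*} [MeasurableSpace 𝒲] {m : Model 𝒲}

lemma exists_isOptAsYouGo (m : Model 𝒲) (c : ℕ → ℝ) :
    ∃ μ : StationaryPolicy m, μ.IsOptAsYouGo c := by
  choose g hg hmin using fun r : ℕ => m.exists_measurable_argmin (Nat.le_add_left 1 r)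
  -- Distances `r ≥ 1` are written `(r - 1) + 1`; no decision is made at the distance `0`.
  classical
  let μ : StationaryPolicy m :=
    { act := fun r w => if r < m.A + m.B ∧ 1 ≤ r ∧ c r < m.minLinkCost r w then none
        else some (g (r - 1) w)
      measurable_act := fun r a => by
        have hs : MeasurableSet {w | r < m.A + m.B ∧ 1 ≤ r ∧ c r < m.minLinkCost r w} := by
          by_cases hr : 1 ≤ r
          · exact (MeasurableSet.const _).inter ((MeasurableSet.const _).inter
              (measurableSet_lt measurable_const (m.measurable_minLinkCost hr)))
          · simp [hr]
        cases a with
        | none => simpa using hs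
        | some γ =>
          convert hs.compl.inter (hg (r - 1) γ) using 1
          ext w
          by_cases h : r < m.A + m.B ∧ 1 ≤ r ∧ c r < m.minLinkCost r w <;>
            simp only [h, if_true, if_false, Set.mem_inter_iff, Set.mem_compl_iff,
              Set.mem_ofPred_eq, Option.some_inj, reduceCtorEq, not_true, not_false_iff,
              false_and, true_and]
      must_place := fun w => by simp }
  refine ⟨μ, ⟨fun r hr hr' w => ?_, fun w => μ.must_place w, fun r hr hr' w γ h γ' hγ' => ?_⟩⟩
  · simp [μ, hr', show 1 ≤ r by omega]
  · have h' : g (r - 1) w = γ := by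
      simp only [μ] at h
      split_ifs at h
      exact Option.some_injective _ h
    have := hmin (r - 1) w γ' hγ'
    rwa [h', Nat.sub_add_cancel (show 1 ≤ r by omega)] at this

/-- A threshold policy attains the minimum in the optimality equation at every state. -/
lemma IsOptAsYouGo.stageCost_add_potential {μ : StationaryPolicy m} {lam : ℝ}
    (hμ : μ.IsOptAsYouGo (m.threshold lam))
    (hlam : m.value lam (m.A + 1) = lam * (m.A + 1 : ℕ)) (ω : Model.Path 𝒲) (k : ℕ) :
    μ.toPolicy.stageCost ω k +
        (μ.toPolicy.potential lam ω (k + 1) - μ.toPolicy.potential lam ω k) =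
      m.bellman lam (μ.toPolicy.dist ω k) (ω k).1 - m.value lam (μ.toPolicy.dist ω k) := by
  have hd := Finset.mem_Icc.1 (μ.toPolicy.dist_mem ω k)
  unfold Policy.potential Model.bellman
  rw [Policy.dist_succ, Policy.pos_succ]
  unfold Policy.stageCost
  have hact : μ.toPolicy.actAt ω k (μ.toPolicy.dist ω k) =
      μ.act (μ.toPolicy.dist ω k) (ω k).1 := rfl
  rw [hact]
  generalize μ.toPolicy.dist ω k = r at hd ⊢
  generalize (ω k).1 = w
  cases h : μ.act r w with
  | none =>
    have hr : r < m.A + m.B := lt_of_le_of_ne hd.2 fun e => hμ.place_last w (e ▸ h)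
    have hc : ¬ m.minLinkCost r w ≤ m.threshold lam r := fun hc =>
      (hμ.place_iff r hd.1 hr w).2 hc h
    rw [if_pos hr, min_eq_right (by
      unfold Model.minHopCost; unfold Model.threshold at hc; linarith)]
    simp only [if_true]
    push_cast
    ring
  | some γ =>
    have hγ : m.linkCost r γ w = m.minLinkCost r w :=
      le_antisymm (Finset.le_inf' _ _ fun γ' hγ' => hμ.power r hd.1 hd.2 w γ h γ' hγ')
        (m.minLinkCost_le r γ.2 w)
    have h2 : (if r < m.A + m.B then min (m.minHopCost r w) (m.value lam (r + 1) - lam)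
        else m.minHopCost r w) = m.minHopCost r w := by
      split_ifs with hr
      · have hc := (hμ.place_iff r hd.1 hr w).1 (by simp [h])
        refine min_eq_left ?_
        unfold Model.minHopCost; unfold Model.threshold at hc; linarith
      · rfl
    rw [h2]
    simp only [reduceCtorEq, if_false, hlam, hγ]
    unfold Model.minHopCost
    push_cast
    ring

end StationaryPolicy

end PureAsYouGo

theorem theorem2 {𝒲 : Type*} [MeasurableSpace 𝒲] (m : PureAsYouGo.Model 𝒲) :
    ∃ c : ℕ → ℝ,
      MonotoneOn c (Set.Ico (m.A + 1) (m.A + m.B)) ∧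
      (∃ μ : PureAsYouGo.StationaryPolicy m, μ.IsOptAsYouGo c) ∧
      ∀ μ : PureAsYouGo.StationaryPolicy m, μ.IsOptAsYouGo c →
        μ.toPolicy.IsAverageCostOptimal := by
  obtain ⟨lam, hlam⟩ := m.exists_optimal_rate
  exact ⟨m.threshold lam, m.monotoneOn_threshold lam,
    PureAsYouGo.StationaryPolicy.exists_isOptAsYouGo m _, fun μ hμ π =>
      (μ.toPolicy.avgCost_le hlam (hμ.stageCost_add_potential hlam)).trans (π.le_avgCost hlam)⟩
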